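/- Let $\overline{\mathbb Q}$ be the field of algebraic numbers. For $\alpha\in\overline{\mathbb Q}$ let $H(\alpha)=\prod_v\max\{1,\|\alpha\|_v\}^{[K_v:\mathbb Q_v]/[K:\mathbb Q]}$ be the absolute multiplicative Weil height, where $K$ is any number field containing $\alpha$, $v$ runs over all places of $K$, $\mathbb Q_v$ is the completion of $\mathbb Q$ at the place below $v$, and $\|\cdot\|_v$ extends the usual absolute value of $\mathbb Q_v$. Let $M(\alpha)=H(\alpha)^{[\mathbb Q(\alpha):\mathbb Q]}$ be the Mahler measure of $\alpha$. For $\alpha\neq 0$ define the metric Mahler measure $$M_1(\alpha)=\inf\Big\{\prod_{n=1}^N M(\alpha_n)\;:\;N\ge 1,\ \alpha_1,\dots,\alpha_N\in\overline{\mathbb Q}^\times,\ \alpha=\prod_{n=1}^N\alpha_n\Big\}.$$ For a number field $K\subseteq\overline{\mathbb Q}$ put $\mathrm{rad}(K)=\{\gamma\in\overline{\mathbb Q}^\times:\gamma^r\in K\text{ for some integer } r\ge 1\}$, and let $K_\alpha\subseteq\overline{\mathbb Q}$ be the Galois closure of $\mathbb Q(\alpha)$ over $\mathbb Q$. **Theorem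 1.1.** For every non-zero algebraic number $\alpha$ there exist $N\ge 1$ and $\alpha_1,\dots,\alpha_N\in\mathrm{rad}(K_\alpha)$ such that $$\alpha=\alpha_1\cdots\alpha_N\qquad\text{and}\qquad M_1(\alpha)=M(\alpha_1)\cdots M(\alpha_N).$$ In particular, the infimum defining $M_1(\alpha)$ is attained. -/

import Mathlib

open scoped IntermediateField

/-! The field of all algebraic numbers is an arbitrary algebraic closure `A` of `ℚ`. -/

/-- The absolute multiplicative Weil height `H(α)` of an algebraic number: the product over the
places `v` of `ℚ(α)` of `max (1, ‖α‖_v ^ ([ℚ(α)_v : ℚ_v] / [ℚ(α) : ℚ]))`. -/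
noncomputable def weilHeight {A : Type*} [Field A] [CharZero A] (α : A) : ℝ :=
  NumberField.absMulHeight₁ α

/-- The Mahler measure `M(α) = H(α) ^ [ℚ(α) : ℚ]`. -/
noncomputable def algMahler {A : Type*} [Field A] [CharZero A] (α : A) : ℝ :=
  weilHeight α ^ Module.finrank ℚ ℚ⟮α⟯

/-- All values `M(α₁) ⋯ M(α_N)`, over `N ≥ 1` and factorizations `α = α₁ ⋯ α_N` into
non-zero algebraic numbers. -/
def factorizationValues {A : Type*} [Field A] [CharZero A] (α : A) : Set ℝ :=
  {t : ℝ | ∃ (N : ℕ) (a : Fin N → A), 0 < N ∧ (∀ i, a i ≠ 0) ∧ α = ∏ i, a i ∧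
    t = ∏ i, algMahler (a i)}

/-- The metric Mahler measure `M₁(α)`. -/
noncomputable def metricMahler {A : Type*} [Field A] [CharZero A] (α : A) : ℝ :=
  sInf (factorizationValues α)

/-- `rad(K)`: the non-zero algebraic numbers having some positive power in `K`. -/
def radSet {A : Type*} [Field A] [CharZero A] (K : IntermediateField ℚ A) : Set A :=
  {γ : A | γ ≠ 0 ∧ ∃ r : ℕ, 0 < r ∧ γ ^ r ∈ K}

/-- `K_α`: the Galois closure of `ℚ(α)` over `ℚ`, inside the field of algebraic numbers. -/
noncomputable def galClosure {A : Type*} [Field A] [CharZero A] (α : A) : IntermediateField ℚ A :=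
  IntermediateField.normalClosure ℚ ℚ⟮α⟯ A

/-- For `α ≠ 0` the infimum is over a non-empty set that is bounded below, so that `M₁(α)` is a
genuine infimum. -/
theorem isGLB_metricMahler {A : Type*} [Field A] [CharZero A] (α : A) (hα : α ≠ 0) :
    IsGLB (factorizationValues α) (metricMahler α) := by
  refine Real.isGLB_sInf ⟨_, 1, fun _ => α, one_pos, fun _ => hα, by simp, rfl⟩ ⟨0, ?_⟩
  rintro t ⟨N, a, -, -, -, rfl⟩
  refine Finset.prod_nonneg fun i _ => pow_nonneg ?_ _
  unfold weilHeight NumberField.absMulHeight₁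
  split_ifs with h
  · have : FiniteDimensional ℚ ℚ⟮a i⟯ := IntermediateField.adjoin.finiteDimensional h
    have : NumberField ℚ⟮a i⟯ := {}
    exact Real.rpow_nonneg (Height.mulHeight₁_pos _).le _
  · exact zero_le_one

/-! Let K be the Galois closure of ℚ(α). In a factorization of α, replace each factor a by a d-th
root b of g = N(a), the norm from K(a) to K, where d = [K(a) : K]. Taking norms of the whole product
shows that the b's multiply to α up to a root of unity, which costs nothing since its Mahler measure
is 1 (`exists_pow_eq_prod_root_norm`).

Normality of K puts g in F = K ∩ ℚ(a). With s = [F : ℚ], b has degree at most sd, and sd is at most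
the degree of a, so M(b) ≤ H(g)^s ≤ M(a) (`exists_root_norm_algMahler_le`).

The middle quantities have g ∈ K and s ≤ [K : ℚ], so by Northcott only finitely many lie below any
bound. The additive monoid generated by their logarithms is therefore well-ordered
(`isWF_closure_logHeightValues`), and a least attainable sum gives a factorization attaining the
infimum. -/

/-! ### Relative heights in extensions of number fields -/

open NumberField Height in
theorem NumberField.InfinitePlace.prod_pow_mult_eq_prod_embeddings {K : Type*} [Field K]
    [NumberField K] (f : InfinitePlace K → ℝ) :
    ∏ v : InfinitePlace K, f v ^ v.mult = ∏ φ : K →+* ℂ, f (InfinitePlace.mk φ) := by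
  classical
  rw [← Finset.prod_fiberwise Finset.univ InfinitePlace.mk (fun φ => f (InfinitePlace.mk φ))]
  refine Finset.prod_congr rfl fun w _ => ?_
  have (φ) (hφ : φ ∈ ({φ | InfinitePlace.mk φ = w} : Finset (K →+* ℂ))) :
      f (InfinitePlace.mk φ) = f w := by rw [(Finset.mem_filter.mp hφ).2]
  rw [Finset.prod_congr rfl this, Finset.prod_const, InfinitePlace.card_filter_mk_eq]

theorem NumberField.card_embeddings_extending {K L : Type*} [Field K] [Field L] [NumberField K]
    [NumberField L] [Algebra K L] [DecidableEq (K →+* ℂ)] (φ : K →+* ℂ) :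
    Finset.card {ψ : L →+* ℂ | ψ.comp (algebraMap K L) = φ} = Module.finrank K L := by
  let := φ.toAlgebra
  have : FiniteDimensional K L := Module.Finite.of_restrictScalars_finite ℚ K L
  rw [← AlgHom.card K L ℂ, ← Fintype.card_subtype]
  exact Fintype.card_congr
    { toFun := fun ψ => { ψ.1 with commutes' := fun r => DFunLike.congr_fun ψ.2 r }
      invFun := fun ψ => ⟨ψ.toRingHom, by ext r; exact ψ.commutes r⟩
      left_inv := fun _ => rfl
      right_inv := fun _ => rfl }

theorem NumberField.prod_embeddings_comp_algebraMap {K L : Type*} [Field K] [Field L]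
    [NumberField K] [NumberField L] [Algebra K L] (f : (K →+* ℂ) → ℝ) :
    ∏ ψ : L →+* ℂ, f (ψ.comp (algebraMap K L)) = (∏ φ : K →+* ℂ, f φ) ^ Module.finrank K L := by
  classical
  rw [← Finset.prod_fiberwise Finset.univ (fun ψ : L →+* ℂ => ψ.comp (algebraMap K L)),
    ← Finset.prod_pow]
  refine Finset.prod_congr rfl fun φ _ => ?_
  rw [← card_embeddings_extending (L := L) φ, ← Finset.prod_const]
  exact Finset.prod_congr rfl fun ψ hψ => by rw [(Finset.mem_filter.mp hψ).2]

-- For integral coordinates the finite places contribute exactly the inverse of the ideal norm. What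
-- remains is archimedean, so passing to an extension needs no analysis of how finite places split.
open NumberField in
theorem NumberField.absNorm_span_mul_mulHeight {K ι : Type*} [Field K] [NumberField K] [Finite ι]
    {x : ι → 𝓞 K} (hx : x ≠ 0) :
    ((Ideal.span (Set.range x)).absNorm : ℝ) * Height.mulHeight (fun i => (x i : K)) =
      ∏ φ : K →+* ℂ, ⨆ i, ‖φ (x i)‖ := by
  have hx' : (fun i => (x i : K)) ≠ 0 := by
    obtain ⟨i, hi⟩ := Function.ne_iff.mp hx
    exact Function.ne_iff.mpr ⟨i, by simpa using hi⟩
  rw [mulHeight_eq hx', mul_left_comm, absNorm_mul_finprod_finitePlace_eq_one hx, mul_one,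
    InfinitePlace.prod_pow_mult_eq_prod_embeddings (fun v => ⨆ i, v (x i : K))]
  rfl

-- Ideal norm and product over embeddings are both raised to the power [L : K] in L, hence so is
-- their quotient.
open NumberField in
theorem NumberField.mulHeight_algebraMap_integers {K L ι : Type*} [Field K] [Field L]
    [NumberField K] [NumberField L] [Algebra K L] [Finite ι] {x : ι → 𝓞 K} (hx : x ≠ 0) :
    Height.mulHeight (fun i => algebraMap K L (x i)) =
      Height.mulHeight (fun i => (x i : K)) ^ Module.finrank K L := by
  have : FiniteDimensional K L := Module.Finite.of_restrictScalars_finite ℚ K L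
  have hK := absNorm_span_mul_mulHeight hx
  let y : ι → 𝓞 L := fun i => algebraMap (𝓞 K) (𝓞 L) (x i)
  have hy : y ≠ 0 := by
    obtain ⟨i, hi⟩ := Function.ne_iff.mp hx
    refine Function.ne_iff.mpr ⟨i, ?_⟩
    simpa [y] using hi
  have hL := absNorm_span_mul_mulHeight hy
  have hspan : Ideal.span (Set.range y) =
      (Ideal.span (Set.range x)).map (algebraMap (𝓞 K) (𝓞 L)) := by
    rw [Ideal.map_span, ← Set.range_comp]; rfl
  have hyx : (fun i => (y i : L)) = fun i => algebraMap K L (x i) := rfl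
  have hprod : ∏ ψ : L →+* ℂ, ⨆ i, ‖ψ (y i)‖ =
      (∏ φ : K →+* ℂ, ⨆ i, ‖φ (x i)‖) ^ Module.finrank K L :=
    prod_embeddings_comp_algebraMap (fun φ : K →+* ℂ => ⨆ i, ‖φ (x i)‖)
  have hne : ((Ideal.span (Set.range x)).absNorm : ℝ) ≠ 0 := by
    rw [Nat.cast_ne_zero, Ne, Ideal.absNorm_eq_zero_iff, Ideal.span_eq_bot]
    intro h
    exact hx (funext fun i => h _ ⟨i, rfl⟩)
  rw [hprod, ← hK, hspan, Ideal.absNorm_algebraMap, mul_pow, Nat.cast_pow, hyx,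
    ← IsFractionRing.finrank_eq (𝓞 K) K (𝓞 L) L] at hL
  exact mul_left_cancel₀ (pow_ne_zero _ hne) hL

open NumberField in
/-- The relative multiplicative height in an extension `L / K` of number fields. -/
theorem NumberField.mulHeight₁_algebraMap {K L : Type*} [Field K] [Field L]
    [NumberField K] [NumberField L] [Algebra K L] (x : K) :
    Height.mulHeight₁ (algebraMap K L x) = Height.mulHeight₁ x ^ Module.finrank K L := by
  obtain ⟨a, b, hb, rfl⟩ := IsFractionRing.div_surjective (A := 𝓞 K) x
  have hb0 : b ≠ 0 := nonZeroDivisors.ne_zero hb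
  have hx : ![a, b] ≠ 0 := Function.ne_iff.mpr ⟨1, by simpa using hb0⟩
  have h := mulHeight_algebraMap_integers (L := L) hx
  have h1 : (fun i => ((![a, b] i : 𝓞 K) : K)) = ![(a : K), (b : K)] := by
    ext i; fin_cases i <;> rfl
  have h2 : (fun i => algebraMap K L ((![a, b] i : 𝓞 K) : K)) =
      ![algebraMap K L a, algebraMap K L b] := by
    ext i; fin_cases i <;> rfl
  rw [h1, h2, ← Height.mulHeight₁_div_eq_mulHeight, ← Height.mulHeight₁_div_eq_mulHeight,
    ← map_div₀] at h
  exact h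

/-! ### The absolute Weil height -/

/-- Allows the height to be computed in any convenient number field; an arbitrary embedding `f` is
allowed so that conjugates can be compared. -/
theorem weilHeight_ringHom {A K : Type*} [Field A] [CharZero A] [Field K] [NumberField K]
    (f : K →+* A) (x : K) :
    weilHeight (f x) = Height.mulHeight₁ x ^ (Module.finrank ℚ K : ℝ)⁻¹ := by
  let : Algebra K A := f.toAlgebra
  have hfx : IsIntegral ℚ (f x) :=
    (Algebra.IsIntegral.isIntegral (R := ℚ) x).map f.toRatAlgHom
  have : FiniteDimensional ℚ ℚ⟮f x⟯ := IntermediateField.adjoin.finiteDimensional hfx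
  have : NumberField ℚ⟮f x⟯ := {}
  have hroot : x ∈ (minpoly ℚ (f x)).aroots K := by
    rw [Polynomial.mem_aroots, show f x = f.toRatAlgHom x from rfl,
      minpoly.algHom_eq _ f.toRatAlgHom.injective]
    exact ⟨minpoly.ne_zero (Algebra.IsIntegral.isIntegral x), minpoly.aeval ℚ x⟩
  let g : ℚ⟮f x⟯ →ₐ[ℚ] K := (IntermediateField.algHomAdjoinIntegralEquiv ℚ hfx).symm ⟨x, hroot⟩
  have hg : g (IntermediateField.AdjoinSimple.gen ℚ (f x)) = x :=
    IntermediateField.algHomAdjoinIntegralEquiv_symm_apply_gen ℚ hfx ⟨x, hroot⟩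
  let : Algebra ℚ⟮f x⟯ K := g.toRingHom.toAlgebra
  have key := NumberField.mulHeight₁_algebraMap (L := K)
    (IntermediateField.AdjoinSimple.gen ℚ (f x))
  rw [show algebraMap ℚ⟮f x⟯ K (IntermediateField.AdjoinSimple.gen ℚ (f x)) = x from hg] at key
  have htower : Module.finrank ℚ ℚ⟮f x⟯ * Module.finrank ℚ⟮f x⟯ K = Module.finrank ℚ K :=
    Module.finrank_mul_finrank ℚ ℚ⟮f x⟯ K
  have hpos : 0 < Module.finrank ℚ K := Module.finrank_pos
  have hne : Module.finrank ℚ⟮f x⟯ K ≠ 0 := fun h => by rw [← htower, h] at hpos; simp at hpos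
  unfold weilHeight NumberField.absMulHeight₁
  rw [dif_pos hfx, key, ← htower, ← Real.rpow_natCast, ← Real.rpow_mul (Height.mulHeight₁_nonneg _)]
  congr 1
  have : (Module.finrank ℚ⟮f x⟯ K : ℝ) ≠ 0 := by exact_mod_cast hne
  push_cast
  field_simp

theorem one_le_weilHeight {A : Type*} [Field A] [CharZero A] (x : A) : 1 ≤ weilHeight x := by
  unfold weilHeight NumberField.absMulHeight₁
  split_ifs with h
  · have : FiniteDimensional ℚ ℚ⟮x⟯ := IntermediateField.adjoin.finiteDimensional h
    have : NumberField ℚ⟮x⟯ := {}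
    exact Real.one_le_rpow (Height.one_le_mulHeight₁ _) (by positivity)
  · exact le_rfl

theorem weilHeight_mul_le {A : Type*} [Field A] [CharZero A] [Algebra.IsAlgebraic ℚ A] (x y : A) :
    weilHeight (x * y) ≤ weilHeight x * weilHeight y := by
  have : FiniteDimensional ℚ ℚ⟮x, y⟯ :=
    IntermediateField.finiteDimensional_adjoin fun z _ => Algebra.IsIntegral.isIntegral z
  have : NumberField ℚ⟮x, y⟯ := {}
  let f := algebraMap ℚ⟮x, y⟯ A
  have hx : x ∈ ℚ⟮x, y⟯ := IntermediateField.subset_adjoin _ _ (by simp)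
  have hy : y ∈ ℚ⟮x, y⟯ := IntermediateField.subset_adjoin _ _ (by simp)
  have h := weilHeight_ringHom f (⟨x, hx⟩ * ⟨y, hy⟩)
  have h1 := weilHeight_ringHom f ⟨x, hx⟩
  have h2 := weilHeight_ringHom f ⟨y, hy⟩
  rw [map_mul] at h
  change weilHeight (x * y) = _ at h
  change weilHeight x = _ at h1
  change weilHeight y = _ at h2
  rw [h, h1, h2, ← Real.mul_rpow (Height.mulHeight₁_nonneg _) (Height.mulHeight₁_nonneg _)]
  exact Real.rpow_le_rpow (Height.mulHeight₁_nonneg _) (Height.mulHeight₁_mul_le _ _)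
    (by positivity)

theorem weilHeight_pow {A : Type*} [Field A] [CharZero A] [Algebra.IsAlgebraic ℚ A] (x : A)
    (n : ℕ) : weilHeight (x ^ n) = weilHeight x ^ n := by
  have : FiniteDimensional ℚ ℚ⟮x⟯ :=
    IntermediateField.adjoin.finiteDimensional (Algebra.IsIntegral.isIntegral x)
  have : NumberField ℚ⟮x⟯ := {}
  let f := algebraMap ℚ⟮x⟯ A
  have h := weilHeight_ringHom f (IntermediateField.AdjoinSimple.gen ℚ x ^ n)
  have h1 := weilHeight_ringHom f (IntermediateField.AdjoinSimple.gen ℚ x)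
  rw [map_pow] at h
  change weilHeight (x ^ n) = _ at h
  change weilHeight x = _ at h1
  rw [h, h1, Height.mulHeight₁_pow, ← Real.rpow_natCast, ← Real.rpow_natCast,
    ← Real.rpow_mul (Height.mulHeight₁_nonneg _), ← Real.rpow_mul (Height.mulHeight₁_nonneg _),
    mul_comm]

theorem weilHeight_eq_one_of_pow_eq_one {A : Type*} [Field A] [CharZero A]
    [Algebra.IsAlgebraic ℚ A] {x : A} {n : ℕ} (hn : n ≠ 0) (h : x ^ n = 1) :
    weilHeight x = 1 := by
  have h1 : weilHeight (1 : A) = 1 := by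
    simpa using weilHeight_ringHom (algebraMap ℚ A) 1
  rw [← h, weilHeight_pow] at h1
  exact (pow_eq_one_iff_of_nonneg (zero_le_one.trans (one_le_weilHeight x)) hn).mp h1

theorem weilHeight_eq_of_minpoly_eq {A : Type*} [Field A] [CharZero A] [Algebra.IsAlgebraic ℚ A]
    {x y : A} (h : minpoly ℚ x = minpoly ℚ y) : weilHeight x = weilHeight y := by
  have hx : IsIntegral ℚ x := Algebra.IsIntegral.isIntegral x
  have : FiniteDimensional ℚ ℚ⟮x⟯ := IntermediateField.adjoin.finiteDimensional hx
  have : NumberField ℚ⟮x⟯ := {}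
  have hroot : y ∈ (minpoly ℚ x).aroots A := by
    rw [Polynomial.mem_aroots, h]
    exact ⟨minpoly.ne_zero (Algebra.IsIntegral.isIntegral y), minpoly.aeval ℚ y⟩
  let g : ℚ⟮x⟯ →ₐ[ℚ] A := (IntermediateField.algHomAdjoinIntegralEquiv ℚ hx).symm ⟨y, hroot⟩
  have hg : g (IntermediateField.AdjoinSimple.gen ℚ x) = y :=
    IntermediateField.algHomAdjoinIntegralEquiv_symm_apply_gen ℚ hx ⟨y, hroot⟩
  rw [← hg]
  exact (weilHeight_ringHom (algebraMap ℚ⟮x⟯ A) (IntermediateField.AdjoinSimple.gen ℚ x)).trans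
    (weilHeight_ringHom g.toRingHom (IntermediateField.AdjoinSimple.gen ℚ x)).symm

theorem weilHeight_multiset_prod_le {A : Type*} [Field A] [CharZero A] [Algebra.IsAlgebraic ℚ A]
    (s : Multiset A) {b : ℝ} (hs : ∀ x ∈ s, weilHeight x ≤ b) :
    weilHeight s.prod ≤ b ^ s.card := by
  induction s using Multiset.induction with
  | empty => simpa using (weilHeight_eq_one_of_pow_eq_one one_ne_zero (one_pow (M := A) 1)).le
  | cons x s ih =>
    rw [Multiset.prod_cons, Multiset.card_cons, pow_succ']
    refine (weilHeight_mul_le x s.prod).trans ?_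
    refine mul_le_mul (hs x (Multiset.mem_cons_self x s))
      (ih fun y hy => hs y (Multiset.mem_cons_of_mem hy))
      (zero_le_one.trans (one_le_weilHeight _)) ?_
    exact zero_le_one.trans ((one_le_weilHeight x).trans (hs x (Multiset.mem_cons_self x s)))

/-- The elements of a number field inside `A` satisfy the Northcott property. -/
theorem finite_setOf_weilHeight_le {A : Type*} [Field A] [CharZero A]
    (K : IntermediateField ℚ A) [FiniteDimensional ℚ K] (B : ℝ) :
    {x : K | weilHeight (x : A) ≤ B}.Finite := by
  have : NumberField K := {}
  refine (NumberField.finite_setOfPred_mulHeight₁_le K (B ^ Module.finrank ℚ K)).subset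
    fun x hx => ?_
  have hn : Module.finrank ℚ K ≠ 0 := Module.finrank_pos.ne'
  have h := weilHeight_ringHom (algebraMap K A) x
  have h' : weilHeight (x : A) ^ Module.finrank ℚ K = Height.mulHeight₁ x := by
    rw [← Real.rpow_inv_natCast_pow (Height.mulHeight₁_nonneg x) hn, ← h]
    rfl
  rw [Set.mem_ofPred_eq, ← h']
  exact pow_le_pow_left₀ (zero_le_one.trans (one_le_weilHeight _)) hx _

/-! ### Degrees, norms and roots of norms -/

open Polynomial IntermediateField

theorem IntermediateField.finrank_restrictScalars_eq {k A : Type*} [Field k] [Field A]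
    [Algebra k A] (F : IntermediateField k A) (E : IntermediateField F A) :
    Module.finrank k (E.restrictScalars k) = Module.finrank k F * Module.finrank F E :=
  (Module.finrank_mul_finrank k F E).symm

theorem IntermediateField.finiteDimensional_restrictScalars {k A : Type*} [Field k] [Field A]
    [Algebra k A] (F : IntermediateField k A) (E : IntermediateField F A)
    [FiniteDimensional k F] [FiniteDimensional F E] :
    FiniteDimensional k (E.restrictScalars k) :=
  Module.Finite.trans (R := k) F E

theorem IntermediateField.natDegree_minpoly_mul_finrank {k L : Type*} [Field k] [Field L]
    [Algebra k L] [FiniteDimensional k L] (x : L) :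
    (minpoly k x).natDegree * Module.finrank k⟮x⟯ L = Module.finrank k L := by
  rw [← adjoin.finrank (Algebra.IsIntegral.isIntegral x), Module.finrank_mul_finrank]

/-- An automorphism fixing `x` preserves the normal field `K`, so it sends the minimal polynomial of
`x` over `K` to itself; the coefficients are thus fixed by the Galois group over ℚ(x). -/
theorem coeff_minpoly_mem_adjoin {A : Type*} [Field A] [CharZero A] [IsAlgClosure ℚ A]
    (K : IntermediateField ℚ A) [Normal ℚ K] (x : A) (i : ℕ) :
    ((minpoly K x).coeff i : A) ∈ ℚ⟮x⟯ := by
  have hx : IsIntegral K x := Algebra.IsIntegral.isIntegral x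
  have : IsGalois ℚ A := {}
  have : IsGalois ℚ⟮x⟯ A := IsGalois.tower_top_of_isGalois ℚ ℚ⟮x⟯ A
  suffices h : ((minpoly K x).coeff i : A) ∈ (⊥ : IntermediateField ℚ⟮x⟯ A) by
    obtain ⟨y, hy⟩ := mem_bot.mp h
    rw [← hy]
    exact y.2
  refine (InfiniteGalois.mem_bot_iff_fixed _).mpr fun f => ?_
  let σ : K ≃ₐ[ℚ] K := (f.restrictScalars ℚ).restrictNormal K
  have hσ (y : K) : (σ y : A) = f y := (f.restrictScalars ℚ).restrictNormal_commutes K y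
  have hfx : f x = x := f.commutes (AdjoinSimple.gen ℚ x)
  have hmap : (minpoly K x).map σ.toRingEquiv.toRingHom = minpoly K x := by
    refine minpoly.eq_of_irreducible_of_monic ?_ ?_ ((minpoly.monic hx).map _)
    · exact (MulEquiv.irreducible_iff (mapEquiv σ.toRingEquiv)).mpr (minpoly.irreducible hx)
    · have h0 := congrArg f (minpoly.aeval K x)
      rw [aeval_def, map_zero, ← RingHom.coe_coe f, hom_eval₂, RingHom.coe_coe, hfx] at h0
      rw [aeval_def, eval₂_map, ← h0]
      congr 1
      ext y
      exact hσ y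
  rw [← hσ]
  conv_rhs => rw [← hmap, coeff_map]
  rfl

theorem finrank_mul_natDegree_minpoly_le {k A : Type*} [Field k] [Field A] [Algebra k A]
    [Algebra.IsAlgebraic k A]
    {F K : IntermediateField k A} (x : A) (hFK : F ≤ K) (hFx : F ≤ k⟮x⟯) :
    Module.finrank k F * (minpoly K x).natDegree ≤ Module.finrank k k⟮x⟯ := by
  have : FiniteDimensional k k⟮x⟯ :=
    adjoin.finiteDimensional (Algebra.IsIntegral.isIntegral x)
  have hx : IsIntegral F x := Algebra.IsIntegral.isIntegral x
  let : Algebra F K := (inclusion hFK).toRingHom.toAlgebra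
  have : IsScalarTower F K A := .of_algebraMap_eq fun _ => rfl
  have hdeg : (minpoly K x).natDegree ≤ (minpoly F x).natDegree := by
    have := natDegree_le_of_dvd (minpoly.dvd_map_of_isScalarTower F K x)
      ((minpoly.monic hx).map _).ne_zero
    rwa [natDegree_map] at this
  have hle : (F⟮x⟯).restrictScalars k ≤ k⟮x⟯ := by
    have : F⟮x⟯ ≤ extendScalars hFx :=
      adjoin_le_iff.mpr (Set.singleton_subset_iff.mpr (mem_adjoin_simple_self k x))
    exact this
  calc _ ≤ Module.finrank k F * Module.finrank F F⟮x⟯ := by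
        rw [adjoin.finrank hx]; exact Nat.mul_le_mul_left _ hdeg
    _ = Module.finrank k ((F⟮x⟯).restrictScalars k) := (finrank_restrictScalars_eq F F⟮x⟯).symm
    _ ≤ _ := finrank_le_of_le_right hle

theorem finrank_adjoin_le_of_pow_mem {k A : Type*} [Field k] [Field A] [Algebra k A]
    [Algebra.IsAlgebraic k A]
    {F : IntermediateField k A} [FiniteDimensional k F] {b : A} {d : ℕ} (hd : d ≠ 0)
    (hb : b ^ d ∈ F) : Module.finrank k k⟮b⟯ ≤ Module.finrank k F * d := by
  have hbi : IsIntegral F b := Algebra.IsIntegral.isIntegral b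
  have : FiniteDimensional F F⟮b⟯ := adjoin.finiteDimensional hbi
  have := finiteDimensional_restrictScalars F F⟮b⟯
  have hle : k⟮b⟯ ≤ (F⟮b⟯).restrictScalars k :=
    adjoin_le_iff.mpr (Set.singleton_subset_iff.mpr (mem_adjoin_simple_self F b))
  have hdeg : (minpoly F b).natDegree ≤ d := by
    have := natDegree_le_natDegree (minpoly.min F b (monic_X_pow_sub_C (⟨b ^ d, hb⟩ : F) hd)
      (by simp))
    rwa [natDegree_X_pow_sub_C] at this
  calc _ ≤ Module.finrank k ((F⟮b⟯).restrictScalars k) := finrank_le_of_le_right hle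
    _ = Module.finrank k F * Module.finrank F F⟮b⟯ := finrank_restrictScalars_eq F F⟮b⟯
    _ ≤ _ := by rw [adjoin.finrank hbi]; exact Nat.mul_le_mul_left _ hdeg

/-- The norm is a product of conjugates of `x`, all of the same height. -/
theorem weilHeight_norm_gen_le {A : Type*} [Field A] [CharZero A] [IsAlgClosure ℚ A]
    (K : IntermediateField ℚ A) (x : A) :
    weilHeight (Algebra.norm K (AdjoinSimple.gen K x) : A) ≤
      weilHeight x ^ (minpoly K x).natDegree := by
  have := IsAlgClosure.isAlgClosed ℚ (K := A)
  have hx : IsIntegral ℚ x := Algebra.IsIntegral.isIntegral x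
  have hsplit := IsAlgClosed.splits ((minpoly K x).map (algebraMap K A))
  have h := AdjoinSimple.norm_gen_eq_prod_roots (K := K) x hsplit
  have hcard : ((minpoly K x).aroots A).card = (minpoly K x).natDegree := by
    rw [aroots, ← hsplit.natDegree_eq_card_roots, natDegree_map]
  rw [show (Algebra.norm K (AdjoinSimple.gen K x) : A) = _ from h, ← hcard]
  refine weilHeight_multiset_prod_le _ fun y hy => (weilHeight_eq_of_minpoly_eq ?_).le
  symm
  refine minpoly.eq_of_irreducible_of_monic (minpoly.irreducible hx) ?_ (minpoly.monic hx)
  obtain ⟨q, hq⟩ := minpoly.dvd_map_of_isScalarTower ℚ K x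
  rw [← aeval_map_algebraMap K, hq, map_mul, (mem_aroots.mp hy).2, zero_mul]

/-- The norm of `x` to a Galois number field `K` has a `[K(x) : K]`-th root whose Mahler measure
is at most that of `x`, and there is a power of the height of the norm between the two. -/
theorem exists_root_norm_algMahler_le {A : Type*} [Field A] [CharZero A] [IsAlgClosure ℚ A]
    (K : IntermediateField ℚ A) [Normal ℚ K] [FiniteDimensional ℚ K] (x : A) :
    ∃ (b : A) (s : ℕ), 0 < s ∧ s ≤ Module.finrank ℚ K ∧
      b ^ (minpoly K x).natDegree = (Algebra.norm K (AdjoinSimple.gen K x) : A) ∧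
      algMahler b ≤ weilHeight (Algebra.norm K (AdjoinSimple.gen K x) : A) ^ s ∧
      weilHeight (Algebra.norm K (AdjoinSimple.gen K x) : A) ^ s ≤ algMahler x := by
  have := IsAlgClosure.isAlgClosed ℚ (K := A)
  have hx : IsIntegral K x := Algebra.IsIntegral.isIntegral x
  have hd : 0 < (minpoly K x).natDegree := minpoly.natDegree_pos hx
  set d := (minpoly K x).natDegree
  set g : A := (Algebra.norm K (AdjoinSimple.gen K x) : A) with hg
  let F : IntermediateField ℚ A := K ⊓ ℚ⟮x⟯
  have hFK : F ≤ K := inf_le_left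
  have : FiniteDimensional ℚ F :=
    Module.Finite.of_injective (inclusion hFK).toLinearMap (inclusion_injective hFK)
  -- Up to sign, the norm is the constant coefficient of the minimal polynomial over `K`.
  have hgF : g ∈ F := by
    refine ⟨SetLike.coe_mem _, ?_⟩
    have h := Algebra.PowerBasis.norm_gen_eq_coeff_zero_minpoly (adjoin.powerBasis hx)
    rw [adjoin.powerBasis_gen, minpoly_gen] at h
    rw [hg, h]
    push_cast
    exact mul_mem (pow_mem (neg_mem (one_mem _)) _) (coeff_minpoly_mem_adjoin K x 0)
  obtain ⟨b, hb⟩ := IsAlgClosed.exists_pow_nat_eq g hd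
  have hbg : weilHeight b ^ d = weilHeight g := by rw [← weilHeight_pow, hb]
  refine ⟨b, Module.finrank ℚ F, Module.finrank_pos, finrank_le_of_le_right hFK, hb, ?_, ?_⟩
  · rw [← hbg, ← pow_mul, mul_comm]
    exact pow_le_pow_right₀ (one_le_weilHeight b)
      (finrank_adjoin_le_of_pow_mem hd.ne' (by rwa [hb]))
  · refine (pow_le_pow_left₀ (zero_le_one.trans (one_le_weilHeight g))
      (weilHeight_norm_gen_le K x) _).trans ?_
    rw [← pow_mul, mul_comm]
    exact pow_le_pow_right₀ (one_le_weilHeight x)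
      (finrank_mul_natDegree_minpoly_le x hFK inf_le_right)

/-- If `α ∈ K` is a product of algebraic numbers `a i`, then up to a root of unity it is also the
product of the `[K(a i) : K]`-th roots of the norms of the `a i` to `K`. -/
theorem exists_pow_eq_prod_root_norm {A : Type*} [Field A] [CharZero A] [IsAlgClosure ℚ A]
    (K : IntermediateField ℚ A) {ι : Type*} [Fintype ι] (a b : ι → A)
    (hb : ∀ i, b i ^ (minpoly K (a i)).natDegree =
      (Algebra.norm K (AdjoinSimple.gen K (a i)) : A)) (hK : ∏ i, a i ∈ K) :
    ∃ n : ℕ, 0 < n ∧ (∏ i, a i) ^ n = (∏ i, b i) ^ n := by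
  let L : IntermediateField K A := adjoin K (Set.range a)
  have : FiniteDimensional K L := by
    have := (Set.finite_range a).to_subtype
    exact finiteDimensional_adjoin fun x _ => Algebra.IsIntegral.isIntegral x
  let c : ι → L := fun i => ⟨a i, subset_adjoin K _ ⟨i, rfl⟩⟩
  let z : K := ⟨∏ i, a i, hK⟩
  have hz : algebraMap K L z = ∏ i, c i := by
    apply Subtype.ext
    push_cast
    rfl
  have hnorm (i : ι) : ((Algebra.norm K (c i) : K) : A) = b i ^ Module.finrank K L := by
    have hi : IsIntegral K (c i) := Algebra.IsIntegral.isIntegral _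
    have h1 : minpoly K (c i) = minpoly K (a i) := IntermediateField.minpoly_eq (c i)
    have h2 : (Algebra.norm K (AdjoinSimple.gen K (c i))) =
        Algebra.norm K (AdjoinSimple.gen K (a i)) := by
      have hai : IsIntegral K (a i) := Algebra.IsIntegral.isIntegral _
      have e1 := Algebra.PowerBasis.norm_gen_eq_coeff_zero_minpoly (adjoin.powerBasis hi)
      have e2 := Algebra.PowerBasis.norm_gen_eq_coeff_zero_minpoly (adjoin.powerBasis hai)
      rw [adjoin.powerBasis_gen, minpoly_gen, adjoin.powerBasis_dim] at e1 e2
      rw [e1, e2, h1]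
    -- Transitivity of the norm through K(a i): the exponents [K(a i) : K] and [L : K(a i)] multiply
    -- to [L : K], independently of `i`.
    rw [Algebra.norm_eq_norm_adjoin, h2, SubmonoidClass.coe_pow, ← hb i, ← pow_mul, ← h1,
      natDegree_minpoly_mul_finrank]
  refine ⟨Module.finrank K L, Module.finrank_pos, ?_⟩
  have h := congrArg (Algebra.norm K) hz
  rw [Algebra.norm_algebraMap, map_prod] at h
  have h' := congrArg (fun y : K => (y : A)) h
  simp only [SubmonoidClass.coe_pow, SubmonoidClass.coe_finsetProd, hnorm] at h'
  rw [← Finset.prod_pow _ _ b, ← h']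

/-! ### Well-ordering of the intermediate values -/

theorem Set.isWF_of_finite_inter_Iic {S : Set ℝ} (h : ∀ B, (S ∩ Set.Iic B).Finite) : S.IsWF := by
  refine Set.isWF_iff_no_descending_seq.mpr fun f hf hfS => ?_
  exact Set.infinite_of_injective_forall_mem (s := S ∩ Set.Iic (f 0)) hf.injective
    (fun n => ⟨hfS n, hf.antitone (Nat.zero_le n)⟩) (h (f 0))

/-- The possible values of the logarithm of a power of height with exponent at most `[K : ℚ]`. -/
def logHeightValues {A : Type*} [Field A] [CharZero A] (K : IntermediateField ℚ A) : Set ℝ :=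
  {t | ∃ (g : K) (s : ℕ), 0 < s ∧ s ≤ Module.finrank ℚ K ∧
    t = Real.log (weilHeight (g : A) ^ s)}

theorem finite_logHeightValues_inter_Iic {A : Type*} [Field A] [CharZero A]
    (K : IntermediateField ℚ A) [FiniteDimensional ℚ K] (B : ℝ) :
    (logHeightValues K ∩ Set.Iic B).Finite := by
  refine ((finite_setOf_weilHeight_le K (Real.exp B)).prod
    (Set.finite_Iic (Module.finrank ℚ K)) |>.image
      fun p => Real.log (weilHeight (p.1 : A) ^ p.2)).subset ?_
  rintro _ ⟨⟨g, s, hs0, hs, rfl⟩, hB⟩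
  have h1 := one_le_weilHeight (g : A)
  refine ⟨(g, s), ⟨?_, hs⟩, rfl⟩
  have hle : weilHeight (g : A) ^ s ≤ Real.exp B :=
    (Real.log_le_iff_le_exp (pow_pos (zero_lt_one.trans_le h1) s)).mp hB
  -- Positivity of `s` matters: the exponent 0 would leave the height of `g` unbounded.
  exact (le_self_pow₀ h1 hs0.ne').trans hle

/-- The generators are nonnegative and well-ordered, which suffices for their finite sums to be
well-ordered. -/
theorem isWF_closure_logHeightValues {A : Type*} [Field A] [CharZero A]
    (K : IntermediateField ℚ A) [FiniteDimensional ℚ K] :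
    (AddSubmonoid.closure (logHeightValues K) : Set ℝ).IsWF := by
  refine (Set.IsPWO.addSubmonoid_closure ?_
    (Set.isWF_of_finite_inter_Iic (finite_logHeightValues_inter_Iic K)).isPWO).isWF
  rintro _ ⟨g, s, -, -, rfl⟩
  exact Real.log_nonneg (one_le_pow₀ (one_le_weilHeight (g : A)))

/-! ### Attaining the infimum -/

theorem mem_galClosure_self {A : Type*} [Field A] [CharZero A] (α : A) : α ∈ galClosure α :=
  IntermediateField.le_normalClosure ℚ⟮α⟯ (IntermediateField.mem_adjoin_simple_self ℚ α)

theorem algMahler_pos {A : Type*} [Field A] [CharZero A] (x : A) : 0 < algMahler x :=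
  pow_pos (zero_lt_one.trans_le (one_le_weilHeight x)) _

/-- A factorization of an element of a Galois number field `K` can be improved to one in `rad(K)`,
and between the two lies a value from a well-ordered set that depends only on `K`. -/
theorem exists_radSet_factorization {A : Type*} [Field A] [CharZero A] [IsAlgClosure ℚ A]
    (K : IntermediateField ℚ A) [Normal ℚ K] [FiniteDimensional ℚ K] {N : ℕ} (a : Fin N → A)
    (ha : ∀ i, a i ≠ 0) (hK : ∏ i, a i ∈ K) :
    ∃ c ∈ AddSubmonoid.closure (logHeightValues K),
      (∃ b : Fin (N + 1) → A, (∀ i, b i ∈ radSet K) ∧ ∏ i, a i = ∏ i, b i ∧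
        ∏ i, algMahler (b i) ≤ Real.exp c) ∧ Real.exp c ≤ ∏ i, algMahler (a i) := by
  choose b s hs0 hs hb hMb hMa using fun i => exists_root_norm_algMahler_le K (a i)
  let g (i : Fin N) : K := Algebra.norm K (AdjoinSimple.gen K (a i))
  have hd (i : Fin N) : 0 < (minpoly K (a i)).natDegree :=
    minpoly.natDegree_pos (Algebra.IsIntegral.isIntegral _)
  have hpos (i : Fin N) : 0 < weilHeight (g i : A) ^ s i :=
    pow_pos (zero_lt_one.trans_le (one_le_weilHeight _)) _
  have hexp : Real.exp (∑ i, Real.log (weilHeight (g i : A) ^ s i)) =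
      ∏ i, weilHeight (g i : A) ^ s i := by
    rw [Real.exp_sum]
    exact Finset.prod_congr rfl fun i _ => Real.exp_log (hpos i)
  obtain ⟨n, hn, hpow⟩ := exists_pow_eq_prod_root_norm K a b hb hK
  have ha0 : ∏ i, a i ≠ 0 := Finset.prod_ne_zero_iff.mpr fun i _ => ha i
  have hb0 : ∏ i, b i ≠ 0 := fun h => by
    rw [h, zero_pow hn.ne'] at hpow
    exact ha0 (pow_eq_zero_iff hn.ne' |>.mp hpow)
  -- The root of unity correcting the product becomes the extra factor in `Fin (N + 1)`.
  let z := (∏ i, a i) / ∏ i, b i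
  have hz : z ^ n = 1 := by rw [div_pow, hpow, div_self (pow_ne_zero n hb0)]
  have hMz : algMahler z = 1 := by
    rw [algMahler, weilHeight_eq_one_of_pow_eq_one hn.ne' hz, one_pow]
  refine ⟨∑ i, Real.log (weilHeight (g i : A) ^ s i), sum_mem fun i _ =>
    AddSubmonoid.subset_closure ⟨g i, s i, hs0 i, hs i, rfl⟩, ⟨Fin.cons z b, ?_, ?_, ?_⟩, ?_⟩
  · refine Fin.cases ⟨div_ne_zero ha0 hb0, n, hn, ?_⟩ fun i => ⟨?_, _, hd i, ?_⟩
    · rw [Fin.cons_zero, hz]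
      exact one_mem K
    · rw [Fin.cons_succ]
      exact Finset.prod_ne_zero_iff.mp hb0 i (Finset.mem_univ i)
    · rw [Fin.cons_succ, hb i]
      exact SetLike.coe_mem _
  · rw [Fin.prod_cons, div_mul_cancel₀ _ hb0]
  · rw [Fin.prod_univ_succ, Fin.cons_zero, hMz, one_mul, hexp]
    simp only [Fin.cons_succ]
    exact Finset.prod_le_prod (fun i _ => (algMahler_pos _).le) fun i _ => hMb i
  · rw [hexp]
    exact Finset.prod_le_prod (fun i _ => (hpos i).le) fun i _ => hMa i

theorem theorem1p1 {A : Type*} [Field A] [CharZero A] [IsAlgClosure ℚ A] (α : A) (hα : α ≠ 0) :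
    ∃ (N : ℕ) (a : Fin N → A), 0 < N ∧ (∀ i, a i ∈ radSet (galClosure α)) ∧
      α = ∏ i, a i ∧ metricMahler α = ∏ i, algMahler (a i) := by
  have : FiniteDimensional ℚ ℚ⟮α⟯ :=
    adjoin.finiteDimensional (Algebra.IsIntegral.isIntegral α)
  have : Normal ℚ (galClosure α) := normalClosure.normal ℚ ℚ⟮α⟯ A
  have : FiniteDimensional ℚ (galClosure α) := normalClosure.is_finiteDimensional ℚ ℚ⟮α⟯ A
  -- The minimum is taken over the intermediate exponents `c`, which are well-ordered, and not over
  -- the Mahler products themselves.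
  let C : Set ℝ := {c | c ∈ AddSubmonoid.closure (logHeightValues (galClosure α)) ∧
    ∃ (N : ℕ) (b : Fin N → A), 0 < N ∧ (∀ i, b i ∈ radSet (galClosure α)) ∧ α = ∏ i, b i ∧
      ∏ i, algMahler (b i) ≤ Real.exp c}
  have hC (t : ℝ) (ht : t ∈ factorizationValues α) : ∃ c ∈ C, Real.exp c ≤ t := by
    obtain ⟨N, a, -, ha, hα, rfl⟩ := ht
    obtain ⟨c, hc, ⟨b, hb, hab, hbc⟩, hca⟩ :=
      exists_radSet_factorization (galClosure α) a ha (hα ▸ mem_galClosure_self α)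
    exact ⟨c, ⟨hc, N + 1, b, N.succ_pos, hb, hα.trans hab, hbc⟩, hca⟩
  have hne : C.Nonempty := by
    obtain ⟨c, hc, -⟩ := hC _ ⟨1, fun _ => α, one_pos, fun _ => hα, by simp, rfl⟩
    exact ⟨c, hc⟩
  have hwf : C.IsWF := (isWF_closure_logHeightValues (galClosure α)).mono fun c hc => hc.1
  obtain ⟨-, N, b, hN, hb, hαb, hle⟩ := hwf.min_mem hne
  have hglb := isGLB_metricMahler α hα
  refine ⟨N, b, hN, hb, hαb, le_antisymm (hglb.1 ⟨N, b, hN, fun i => (hb i).1, hαb, rfl⟩)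
    (hglb.2 fun t ht => ?_)⟩
  obtain ⟨c, hc, hct⟩ := hC t ht
  exact hle.trans ((Real.exp_le_exp.mpr (hwf.min_le hne hc)).trans hct)
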